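/- Let $k\ge 1$ and $I=\mathbb{Z}/(k+1)$. An affine permutation is a bijection $x:\mathbb{Z}\to\mathbb{Z}$ with $x(i+k+1)=x(i)+k+1$ for all $i$ and $\sum_{i=1}^{k+1}x(i)=\binom{k+2}{2}$. For $i\in I$ let $s_i$ be the affine permutation exchanging $m(k+1)+i$ and $m(k+1)+i+1$ for every $m\in\mathbb{Z}$. For $A\subsetneq I$ let $d_A$ (resp. $u_A$) be the product of the $s_i$, $i\in A$, each taken once, in an order in which $j$ is to the left (resp. to the right) of $j-1$ whenever $j,j-1\in A$. A decreasing (resp. increasing) decomposition of $x$ is a finite sequence $(A_1,\dots,A_n)$ of nonempty proper subsets of $I$ such that $x=d_{A_n}\cdots d_{A_1}$ (resp. $x=u_{A_n}\cdots u_{A_1}$) and this product is reduced (equivalently, the corresponding product in the affine nil-Coxeter monoid is nonzero). It is right maximal if $(|A_1|,\dots,|A_n|)$ is lexicographically maximal among all decreasing (resp. increasing) decompositions of $x$, and left maximal if $(|A_n|,\dots,|A_1|)$ is. A $k$-code is a function $\alpha:I\to\mathbb{Z}_{\ge 0}$ with at least one value $0$. Its diagram has $\alpha_i$ boxes in column $i\in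 I$, namely those in rows $1,\dots,\alpha_i$. **Proposition.** Let $x$ be an affine permutation. Then $x$ has a unique right maximal and a unique left maximal decreasing decomposition, and a unique right maximal and a unique left maximal increasing decomposition. There are unique $k$-codes $\mathrm{RD}(x),\mathrm{RI}(x),\mathrm{LD}(x),\mathrm{LI}(x)$ such that the set of residues in row $j$ of the filled diagram is, for every $j\ge 1$, the $j$-th factor of the right maximal decreasing, right maximal increasing, left maximal decreasing, left maximal increasing decomposition, respectively (the factors being counted from the right for $\mathrm{RD}$, $\mathrm{RI}$ and from the left for $\mathrm{LD}$, $\mathrm{LI}$, and being empty after the last one); here the box in column $i$ and row $j$ is marked with the residue $i-j$ for $\mathrm{RD}$ and $\mathrm{LI}$, and with the residue $i+j$ for $\mathrm{RI}$ and $\mathrm{LD}$. Moreover, for every integer $i$ (in particular for $i=1,\dots,k+1$), with column indices read modulo $k+1$ and all the sets below finite, $$\mathrm{RD}(x)_i=\mathrm{CRD}(x)_i:=\#\{j<i : x(j)>x(i)\},$$ $$\mathrm{RI}(x)_i=\mathrm{CRI}(x)_i:=\#\{j>i+1 : x(j)<x(i+1)\},$$ $$\mathrm{LD}(x)_i=\mathrm{CLD}(x)_i:=\#\{j<x^{-1}(i+1)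 : x(j)>i+1\},$$ $$\mathrm{LI}(x)_i=\mathrm{CLI}(x)_i:=\#\{j>x^{-1}(i) : x(j)<i\}.$$ -/

import Mathlib

namespace AffineCodes

/-- A bijection `x : ℤ → ℤ` is an affine permutation (an element of the affine symmetric group
with generators indexed by `ℤ/(k+1)`) if `x (i + k + 1) = x i + k + 1` for all `i` and
`x 1 + ⋯ + x (k+1) = binom (k+2) 2`. -/
def IsAffinePermutation (k : ℕ) (x : Equiv.Perm ℤ) : Prop :=
  (∀ i : ℤ, x (i + (k + 1)) = x i + (k + 1)) ∧
    ∑ i ∈ Finset.Icc (1 : ℤ) (k + 1), x i = ((k + 2).choose 2 : ℤ)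

/-- The map exchanging `m(k+1)+i` and `m(k+1)+i+1` for every integer `m`. -/
def swapMap (k : ℕ) (i : ZMod (k + 1)) (m : ℤ) : ℤ :=
  if (m : ZMod (k + 1)) = i then m + 1
  else if (m : ZMod (k + 1)) = i + 1 then m - 1
  else m

theorem swapMap_involutive (k : ℕ) [NeZero k] (i : ZMod (k + 1)) :
    Function.Involutive (swapMap k i) := by
  have hk : 0 < k := Nat.pos_of_ne_zero (NeZero.ne k)
  have : Fact (1 < k + 1) := ⟨by omega⟩
  have h1 : (1 : ZMod (k + 1)) ≠ 0 := one_ne_zero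
  intro m
  unfold swapMap
  by_cases h : (m : ZMod (k + 1)) = i
  · simp [h, h1]
  · by_cases h' : (m : ZMod (k + 1)) = i + 1
    · simp [h', h1]
    · simp [h, h']

/-- The simple transposition `s_i`, `i ∈ ℤ/(k+1)`. -/
def simpleTransposition (k : ℕ) [NeZero k] (i : ZMod (k + 1)) : Equiv.Perm ℤ :=
  (swapMap_involutive k i).toPerm

/-- The product `s_{w_1} ⋯ s_{w_l}` of a word `w = (w_1, …, w_l)`. -/
def wordProd (k : ℕ) [NeZero k] (w : List (ZMod (k + 1))) : Equiv.Perm ℤ :=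
  (w.map (simpleTransposition k)).prod

/-- `w` is a reduced word for `x`: a word of minimal length among those with product `x`. -/
def IsReducedWord {k : ℕ} [NeZero k] (w : List (ZMod (k + 1))) (x : Equiv.Perm ℤ) : Prop :=
  wordProd k w = x ∧ ∀ v : List (ZMod (k + 1)), wordProd k v = x → w.length ≤ v.length

/-- The two kinds of cyclic elements. -/
inductive Kind
  | decreasing
  | increasing

/-- `w` is a word of the cyclically decreasing element `d_A` (resp. of the cyclically increasing
element `u_A`): every element of `A` occurs in `w` exactly once and nothing else does, and whenever
`j` and `j - 1` both lie in `A`, the letter `j` is to the left (resp. to the right) of `j - 1`. -/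
def IsCyclicWord {k : ℕ} (t : Kind) (A : Finset (ZMod (k + 1))) (w : List (ZMod (k + 1))) : Prop :=
  w.Nodup ∧ w.toFinset = A ∧
    ∀ j, j ∈ A → j - 1 ∈ A →
      match t with
      | .decreasing => w.idxOf j < w.idxOf (j - 1)
      | .increasing => w.idxOf (j - 1) < w.idxOf j

/-- The list `A = [A_1, …, A_n]` of nonempty proper subsets of `ℤ/(k+1)` is a decomposition
`x = d_{A_n} ⋯ d_{A_1}` (resp. `x = u_{A_n} ⋯ u_{A_1}`) as a reduced product. Equivalently, the
product on the right is nonzero in the affine nil-Coxeter monoid and is the element of `x`. -/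
def IsDecomposition {k : ℕ} [NeZero k] (t : Kind) (x : Equiv.Perm ℤ)
    (A : List (Finset (ZMod (k + 1)))) : Prop :=
  (∀ S ∈ A, S.Nonempty ∧ S ≠ Finset.univ) ∧
    ∃ ws : List (List (ZMod (k + 1))),
      List.Forall₂ (IsCyclicWord t) A ws ∧ IsReducedWord ws.reverse.flatten x

/-- The decomposition `[A_1, …, A_n]` is maximal from the right: the shape `(|A_1|, …, |A_n|)` is
lexicographically maximal. -/
def IsMaximalRight {k : ℕ} [NeZero k] (t : Kind) (x : Equiv.Perm ℤ)
    (A : List (Finset (ZMod (k + 1)))) : Prop :=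
  IsDecomposition t x A ∧
    ∀ B : List (Finset (ZMod (k + 1))), IsDecomposition t x B → B.map Finset.card ≤ A.map Finset.card

/-- The decomposition `[A_1, …, A_n]` is maximal from the left: `(|A_n|, …, |A_1|)` is
lexicographically maximal. -/
def IsMaximalLeft {k : ℕ} [NeZero k] (t : Kind) (x : Equiv.Perm ℤ)
    (A : List (Finset (ZMod (k + 1)))) : Prop :=
  IsDecomposition t x A ∧
    ∀ B : List (Finset (ZMod (k + 1))), IsDecomposition t x B → B.reverse.map Finset.card ≤ A.reverse.map Finset.card

/-- A `k`-code: a function `ℤ/(k+1) → ℕ` which vanishes somewhere. -/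
structure KCode (k : ℕ) where
  toFun : ZMod (k + 1) → ℕ
  exists_eq_zero : ∃ i, toFun i = 0

instance (k : ℕ) : CoeFun (KCode k) (fun _ => ZMod (k + 1) → ℕ) := ⟨KCode.toFun⟩

/-- Row `j` (`j ≥ 1`) of the filling of the diagram of `α` in which column `i` has `α i` boxes and
the box in column `i` and row `j` is marked with the residue `i - j`. -/
def rowSub {k : ℕ} (α : KCode k) (j : ℕ) : Finset (ZMod (k + 1)) :=
  (Finset.univ.filter fun i => j ≤ α i).image fun i => i - (j : ZMod (k + 1))

/-- Row `j` (`j ≥ 1`) of the filling of the diagram of `α` in which column `i` has `α i` boxes and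
the box in column `i` and row `j` is marked with the residue `i + j`. -/
def rowAdd {k : ℕ} (α : KCode k) (j : ℕ) : Finset (ZMod (k + 1)) :=
  (Finset.univ.filter fun i => j ≤ α i).image fun i => i + (j : ZMod (k + 1))

/-- `α` is the `k`-code `RD(x)`: `x` has a unique maximal right decreasing decomposition
`[A_1, …, A_n]`, and row `j` of the filling of `α` (box `(i, j)` marked `i - j`) is `A_j`, the rows
beyond the `n`-th being empty. -/
def IsRD {k : ℕ} [NeZero k] (x : Equiv.Perm ℤ) (α : KCode k) : Prop :=
  ∃ A, (∀ B, IsMaximalRight .decreasing x B ↔ B = A) ∧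
    ∀ j : ℕ, A.getD j ∅ = rowSub α (j + 1)

/-- `α` is the `k`-code `RI(x)`: as for `RD(x)`, with the maximal right increasing decomposition
and with box `(i, j)` marked `i + j`. -/
def IsRI {k : ℕ} [NeZero k] (x : Equiv.Perm ℤ) (α : KCode k) : Prop :=
  ∃ A, (∀ B, IsMaximalRight .increasing x B ↔ B = A) ∧
    ∀ j : ℕ, A.getD j ∅ = rowAdd α (j + 1)

/-- `α` is the `k`-code `LD(x)`, from the maximal left decreasing decomposition `[A_1, …, A_n]`:
row `j` is the `j`-th factor from the left, `A_{n+1-j}`, and box `(i, j)` is marked `i + j`. -/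
def IsLD {k : ℕ} [NeZero k] (x : Equiv.Perm ℤ) (α : KCode k) : Prop :=
  ∃ A, (∀ B, IsMaximalLeft .decreasing x B ↔ B = A) ∧
    ∀ j : ℕ, A.reverse.getD j ∅ = rowAdd α (j + 1)

/-- `α` is the `k`-code `LI(x)`, from the maximal left increasing decomposition `[A_1, …, A_n]`:
row `j` is the `j`-th factor from the left, `A_{n+1-j}`, and box `(i, j)` is marked `i - j`. -/
def IsLI {k : ℕ} [NeZero k] (x : Equiv.Perm ℤ) (α : KCode k) : Prop :=
  ∃ A, (∀ B, IsMaximalLeft .increasing x B ↔ B = A) ∧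
    ∀ j : ℕ, A.reverse.getD j ∅ = rowSub α (j + 1)

/-- Right decreasing affine code: the number of `j < i` with `x j > x i`. -/
noncomputable def CRD (x : Equiv.Perm ℤ) (i : ℤ) : ℕ∞ :=
  {j : ℤ | j < i ∧ x j > x i}.encard

/-- Right increasing affine code: the number of `j > i + 1` with `x j < x (i + 1)`. -/
noncomputable def CRI (x : Equiv.Perm ℤ) (i : ℤ) : ℕ∞ :=
  {j : ℤ | j > i + 1 ∧ x j < x (i + 1)}.encard

/-- Left decreasing affine code: the number of `j < x⁻¹ (i + 1)` with `x j > i + 1`. -/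
noncomputable def CLD (x : Equiv.Perm ℤ) (i : ℤ) : ℕ∞ :=
  {j : ℤ | j < x.symm (i + 1) ∧ x j > i + 1}.encard

/-- Left increasing affine code: the number of `j > x⁻¹ i` with `x j < i`. -/
noncomputable def CLI (x : Equiv.Perm ℤ) (i : ℤ) : ℕ∞ :=
  {j : ℤ | j > x.symm i ∧ x j < i}.encard

end AffineCodes

/-! Everything is read off the inversion code `c` of `x`, where `c a` counts the inversions whose
larger position lies in the class `a`. Right multiplication by `s_i` exchanges the entries `i` and
`i + 1`. If `c i < c (i + 1)`, the entry arriving at `i` then drops by one, otherwise the entry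
arriving at `i + 1` grows by one (`IsPeriodic.code_mul_simpleTransposition`). Each letter thus
changes the sum of the code by one, and this sum turns out to be the length of `x`.

In a reduced product `x = y d_A`, undoing the letters of `d_A` must lower the sum each time. This
forces `A` into the first row of the diagram of `c` (`IsCyclicWord.subset_codeRow`). Conversely the
whole first row can be removed, which leaves the code of the remaining rows
(`IsCyclicWord.foldr_codeStep`). Removing rows greedily reaches code zero, that is, the identity.
The rows therefore form a decomposition, and comparing factor by factor shows that it is the unique
maximal one (`map_card_le_codeRows`).

This settles `RD`. Conjugation by `m ↦ -m` exchanges increasing and decreasing and gives `RI`;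
inversion reverses decompositions and gives `LI` and `LD`. -/

namespace AffineCodes

/-! ### Periodic permutations and their inversion codes -/

/-- The bijection `x` commutes with the translation by `k + 1`. -/
def IsPeriodic (k : ℕ) (x : Equiv.Perm ℤ) : Prop :=
  ∀ i : ℤ, x (i + (k + 1)) = x i + (k + 1)

theorem IsPeriodic.apply_add_mul {k : ℕ} {x : Equiv.Perm ℤ} (hx : IsPeriodic k x) (i q : ℤ) :
    x (i + q * (k + 1)) = x i + q * (k + 1) := by
  induction q using Int.induction_on with
  | zero => simp
  | succ n ih =>
    have := hx (i + n * (k + 1))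
    rw [show i + ((n : ℤ) + 1) * (k + 1) = i + n * (k + 1) + (k + 1) by ring, this, ih]
    ring
  | pred n ih =>
    have := hx (i + (-n - 1) * (k + 1))
    rw [show i + (-(n : ℤ) - 1) * (k + 1) + (k + 1) = i + (-n) * (k + 1) by ring, ih] at this
    linarith

theorem exists_eq_add_mul_of_cast_eq {k : ℕ} {m m' : ℤ}
    (h : (m : ZMod (k + 1)) = (m' : ZMod (k + 1))) : ∃ q : ℤ, m' = m + q * (k + 1) := by
  rw [ZMod.intCast_eq_intCast_iff_dvd_sub] at h
  obtain ⟨q, hq⟩ := h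
  refine ⟨q, ?_⟩
  push_cast at hq
  linarith

theorem IsPeriodic.sub_self_eq {k : ℕ} {x : Equiv.Perm ℤ} (hx : IsPeriodic k x) {m m' : ℤ}
    (h : (m : ZMod (k + 1)) = (m' : ZMod (k + 1))) : x m' - m' = x m - m := by
  obtain ⟨q, rfl⟩ := exists_eq_add_mul_of_cast_eq h
  rw [hx.apply_add_mul]
  ring

theorem IsPeriodic.mul {k : ℕ} {x y : Equiv.Perm ℤ} (hx : IsPeriodic k x) (hy : IsPeriodic k y) :
    IsPeriodic k (x * y) := fun i => by
  rw [Equiv.Perm.mul_apply, hy, hx, Equiv.Perm.mul_apply]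

theorem IsPeriodic.one {k : ℕ} : IsPeriodic k 1 := fun _ => rfl

/-- The displacement of `x` at a residue class. -/
def displacement {k : ℕ} (x : Equiv.Perm ℤ) (a : ZMod (k + 1)) : ℤ := x a.val - a.val

theorem cast_val {k : ℕ} (a : ZMod (k + 1)) : (((a.val : ℕ) : ℤ) : ZMod (k + 1)) = a := by
  simp

theorem IsPeriodic.displacement_cast {k : ℕ} {x : Equiv.Perm ℤ} (hx : IsPeriodic k x) (m : ℤ) :
    displacement x (m : ZMod (k + 1)) = x m - m :=
  hx.sub_self_eq (cast_val (m : ZMod (k + 1))).symm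

/-- The set of inversions of `x` whose larger position is `m`. -/
def inversions (x : Equiv.Perm ℤ) (m : ℤ) : Set ℤ := {j | j < m ∧ x m < x j}

/-- The displacement takes finitely many values, so it has an upper bound `M`; an inversion `j` then
satisfies `x m < x j ≤ j + M`. -/
theorem IsPeriodic.finite_inversions {k : ℕ} {x : Equiv.Perm ℤ} (hx : IsPeriodic k x) (m : ℤ) :
    (inversions x m).Finite := by
  obtain ⟨M, hM⟩ := (Set.finite_range (displacement (k := k) x)).bddAbove
  refine (Set.finite_Ioo (x m - M - 1) m).subset ?_
  rintro j ⟨hj, hxj⟩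
  have := hM ⟨(j : ZMod (k + 1)), rfl⟩
  rw [hx.displacement_cast] at this
  exact ⟨by linarith, hj⟩

/-- The right decreasing code of `x`, as a function on residues. -/
noncomputable def code (k : ℕ) (x : Equiv.Perm ℤ) (a : ZMod (k + 1)) : ℕ :=
  (inversions x a.val).ncard

theorem IsPeriodic.ncard_inversions_eq {k : ℕ} {x : Equiv.Perm ℤ} (hx : IsPeriodic k x) {m m' : ℤ}
    (h : (m : ZMod (k + 1)) = (m' : ZMod (k + 1))) :
    (inversions x m).ncard = (inversions x m').ncard := by
  obtain ⟨q, rfl⟩ := exists_eq_add_mul_of_cast_eq h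
  have : inversions x (m + q * (k + 1)) = (fun j => j + q * (k + 1)) '' inversions x m := by
    ext j
    constructor
    · rintro ⟨h1, h2⟩
      refine ⟨j - q * (k + 1), ⟨by linarith, ?_⟩, by ring⟩
      have := hx.apply_add_mul (j - q * (k + 1)) q
      rw [sub_add_cancel] at this
      rw [hx.apply_add_mul] at h2
      linarith
    · rintro ⟨j, ⟨h1, h2⟩, rfl⟩
      refine ⟨by linarith, ?_⟩
      rw [hx.apply_add_mul, hx.apply_add_mul]
      linarith
  rw [this, Set.ncard_image_of_injective _ (add_left_injective _)]

theorem IsPeriodic.code_cast {k : ℕ} {x : Equiv.Perm ℤ} (hx : IsPeriodic k x) (m : ℤ) :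
    code k x (m : ZMod (k + 1)) = (inversions x m).ncard :=
  hx.ncard_inversions_eq (cast_val _)

theorem IsPeriodic.coe_code_cast {k : ℕ} {x : Equiv.Perm ℤ} (hx : IsPeriodic k x) (m : ℤ) :
    (code k x (m : ZMod (k + 1)) : ℕ∞) = CRD x m := by
  rw [hx.code_cast, (hx.finite_inversions m).cast_ncard_eq]
  rfl

/-- At a position of maximal displacement no earlier position can have a larger value. -/
theorem IsPeriodic.exists_code_eq_zero {k : ℕ} {x : Equiv.Perm ℤ} (hx : IsPeriodic k x) :
    ∃ a, code k x a = 0 := by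
  obtain ⟨a, ha⟩ := Finite.exists_max (displacement (k := k) x)
  refine ⟨a, ?_⟩
  have : inversions x a.val = ∅ := by
    ext j
    simp only [inversions, Set.mem_ofPred_eq, Set.mem_empty_iff_false, iff_false, not_and, not_lt]
    intro hj
    have := ha (j : ZMod (k + 1))
    rw [hx.displacement_cast, displacement] at this
    linarith
  rw [code, this, Set.ncard_empty]

theorem code_one (k : ℕ) : code k 1 = 0 := by
  funext a
  have : inversions 1 a.val = ∅ := by
    ext j
    simp only [inversions, Set.mem_ofPred_eq, Set.mem_empty_iff_false, iff_false, not_and, not_lt,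
      Equiv.Perm.coe_one, id]
    exact le_of_lt
  rw [code, this, Set.ncard_empty, Pi.zero_apply]

/-! ### The normalisation of affine permutations -/

/-- `x` commutes with the translation by `k + 1` and its displacements add up to zero. -/
structure IsAffine (k : ℕ) (x : Equiv.Perm ℤ) : Prop where
  isPeriodic : IsPeriodic k x
  sum_displacement : ∑ a : ZMod (k + 1), displacement x a = 0

theorem isAffine_one {k : ℕ} : IsAffine k 1 :=
  ⟨IsPeriodic.one, Finset.sum_eq_zero fun a _ => by simp [displacement]⟩

theorem sum_Icc_eq_sum_zmod {k : ℕ} (f : ZMod (k + 1) → ℤ) :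
    ∑ i ∈ Finset.Icc (1 : ℤ) (k + 1), f i = ∑ a : ZMod (k + 1), f a := by
  refine Finset.sum_bij (fun m _ => (m : ZMod (k + 1))) (fun _ _ => Finset.mem_univ _) ?_ ?_
    (fun _ _ => rfl)
  · intro m hm m' hm' h
    obtain ⟨q, hq⟩ := exists_eq_add_mul_of_cast_eq h
    rw [Finset.mem_Icc] at hm hm'
    have h1 : q < 1 := by
      by_contra h1
      nlinarith
    have h2 : -1 < q := by
      by_contra h1
      nlinarith
    obtain rfl : q = 0 := by omega
    simpa using hq.symm
  · intro a _
    -- The shift by one makes the representative run over `1, …, k + 1` instead of `0, …, k`.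
    refine ⟨((a - 1).val : ℤ) + 1, ?_, by simp⟩
    have := (a - 1).val_lt
    rw [Finset.mem_Icc]
    omega

theorem sum_Icc_int (n : ℕ) : ∑ i ∈ Finset.Icc (1 : ℤ) n, i = ((n + 1).choose 2 : ℤ) := by
  induction n with
  | zero => simp
  | succ n ih =>
    have : Finset.Icc (1 : ℤ) ((n + 1 : ℕ) : ℤ) = insert ((n : ℤ) + 1) (Finset.Icc (1 : ℤ) n) := by
      ext j
      simp only [Finset.mem_Icc, Finset.mem_insert]
      push_cast
      omega
    rw [this, Finset.sum_insert (by simp), ih, Nat.choose_succ_succ' (n + 1) 1]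
    simp

theorem IsAffinePermutation.isAffine {k : ℕ} {x : Equiv.Perm ℤ} (hx : IsAffinePermutation k x) :
    IsAffine k x := by
  have hp : IsPeriodic k x := hx.1
  refine ⟨hp, ?_⟩
  rw [← sum_Icc_eq_sum_zmod, Finset.sum_congr rfl fun i _ => hp.displacement_cast i,
    Finset.sum_sub_distrib, hx.2]
  have := sum_Icc_int (k + 1)
  push_cast at this
  rw [this, sub_self]

/-- Without inversions `x` is increasing, and an increasing bijection of `ℤ` is a translation. The
vanishing sum of displacements makes it trivial. -/
theorem IsAffine.eq_one_of_code_eq_zero {k : ℕ} {x : Equiv.Perm ℤ} (hx : IsAffine k x)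
    (h : code k x = 0) : x = 1 := by
  have hp := hx.isPeriodic
  have hmono : StrictMono x := by
    refine strictMono_int_of_lt_succ fun m => ?_
    have h1 := hp.code_cast (m + 1)
    rw [h, Pi.zero_apply] at h1
    have h2 := (Set.ncard_eq_zero (hp.finite_inversions (m + 1))).1 h1.symm
    have h3 : m ∉ inversions x (m + 1) := by rw [h2]; exact Set.notMem_empty m
    have h4 : x m ≠ x (m + 1) := fun h => by
      have := x.injective h
      omega
    have h5 : ¬ x (m + 1) < x m := fun h => h3 ⟨by omega, h⟩
    omega
  have hsucc : ∀ m, x (m + 1) = x m + 1 := by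
    intro m
    have h1 := hmono (show m < m + 1 by omega)
    obtain ⟨j, hj⟩ := x.surjective (x m + 1)
    have h2 : m < j := hmono.lt_iff_lt.1 (by omega)
    have h3 := hmono.monotone (show m + 1 ≤ j by omega)
    omega
  have htrans : ∀ m, x m - m = x 0 - 0 := by
    intro m
    induction m using Int.induction_on with
    | zero => rfl
    | succ n ih =>
      have := hsucc n
      omega
    | pred n ih =>
      have := hsucc (-n - 1)
      rw [sub_add_cancel] at this
      omega
  have h0 := hx.sum_displacement
  simp only [displacement, htrans] at h0
  rw [Finset.sum_const, Finset.card_univ, ZMod.card, nsmul_eq_mul, mul_eq_zero] at h0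
  have h1 : x 0 = 0 := by
    rcases h0 with h0 | h0
    · exact absurd h0 (by positivity)
    · simpa using h0
  ext m
  have := htrans m
  rw [Equiv.Perm.coe_one, id]
  omega

/-! ### Simple transpositions and their action on codes -/

section simple

variable {k : ℕ} [NeZero k]

theorem zmod_one_ne_zero : (1 : ZMod (k + 1)) ≠ 0 := by
  have hk : 0 < k := Nat.pos_of_ne_zero (NeZero.ne k)
  have : Fact (1 < k + 1) := ⟨by omega⟩
  exact one_ne_zero

theorem simpleTransposition_apply (i : ZMod (k + 1)) (m : ℤ) :
    simpleTransposition k i m = if (m : ZMod (k + 1)) = i then m + 1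
      else if (m : ZMod (k + 1)) = i + 1 then m - 1 else m := rfl

theorem simpleTransposition_apply_cast (p : ℤ) :
    simpleTransposition k (p : ZMod (k + 1)) p = p + 1 := by
  simp [simpleTransposition_apply]

theorem simpleTransposition_apply_cast_add_one (p : ℤ) :
    simpleTransposition k (p : ZMod (k + 1)) (p + 1) = p := by
  simp [simpleTransposition_apply, zmod_one_ne_zero]

theorem simpleTransposition_mul_self (i : ZMod (k + 1)) :
    simpleTransposition k i * simpleTransposition k i = 1 :=
  Equiv.ext (swapMap_involutive k i)

theorem simpleTransposition_inv (i : ZMod (k + 1)) :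
    (simpleTransposition k i)⁻¹ = simpleTransposition k i :=
  inv_eq_of_mul_eq_one_left (simpleTransposition_mul_self i)

theorem simpleTransposition_apply_apply (i : ZMod (k + 1)) (m : ℤ) :
    simpleTransposition k i (simpleTransposition k i m) = m :=
  swapMap_involutive k i m

theorem isPeriodic_simpleTransposition (i : ZMod (k + 1)) :
    IsPeriodic k (simpleTransposition k i) := fun m => by
  have : (((m + (k + 1) : ℤ)) : ZMod (k + 1)) = m := by
    have := ZMod.natCast_self (k + 1)
    push_cast at this ⊢
    rw [this, add_zero]
  simp only [simpleTransposition_apply, this]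
  split_ifs <;> ring

/-- A threshold separates two exchanged neighbours only when it is the larger of the two. -/
theorem simpleTransposition_lt_iff {i : ZMod (k + 1)} {m : ℤ} (h : (m : ZMod (k + 1)) ≠ i + 1)
    (j : ℤ) : simpleTransposition k i j < m ↔ j < m := by
  have h1 : (j : ZMod (k + 1)) = i → j + 1 ≠ m := by
    rintro h1 rfl
    exact h (by push_cast; rw [h1])
  have h2 : (j : ZMod (k + 1)) = i + 1 → j ≠ m := by
    rintro h2 rfl
    exact h h2
  rw [simpleTransposition_apply]
  split_ifs with h3 h4
  · have := h1 h3
    omega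
  · have := h2 h4
    omega
  · rfl

theorem ncard_inversions_mul_of_ne {x : Equiv.Perm ℤ} {i : ZMod (k + 1)} {m : ℤ}
    (h : (m : ZMod (k + 1)) ≠ i) (h' : (m : ZMod (k + 1)) ≠ i + 1) :
    (inversions (x * simpleTransposition k i) m).ncard = (inversions x m).ncard := by
  have hm : simpleTransposition k i m = m := by simp [simpleTransposition_apply, h, h']
  rw [← Set.ncard_image_of_injective _ (simpleTransposition k i).injective]
  congr 1
  ext j
  constructor
  · rintro ⟨j, ⟨h1, h2⟩, rfl⟩
    rw [Equiv.Perm.mul_apply, Equiv.Perm.mul_apply, hm] at h2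
    exact ⟨(simpleTransposition_lt_iff h' j).2 h1, h2⟩
  · rintro ⟨h1, h2⟩
    refine ⟨simpleTransposition k i j, ⟨(simpleTransposition_lt_iff h' j).2 h1, ?_⟩,
      simpleTransposition_apply_apply i j⟩
    rw [Equiv.Perm.mul_apply, Equiv.Perm.mul_apply, hm, simpleTransposition_apply_apply]
    exact h2

theorem cast_ne_cast_add_one (p : ℤ) : (p : ZMod (k + 1)) ≠ (p : ZMod (k + 1)) + 1 := by
  simpa using zmod_one_ne_zero (k := k)

theorem image_inversions_mul (x : Equiv.Perm ℤ) (p : ℤ) :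
    simpleTransposition k (p : ZMod (k + 1)) ''
      inversions (x * simpleTransposition k (p : ZMod (k + 1))) p =
      {j | j < p ∧ x (p + 1) < x j} := by
  have h' := cast_ne_cast_add_one (k := k) p
  ext j
  constructor
  · rintro ⟨j, ⟨h1, h2⟩, rfl⟩
    rw [Equiv.Perm.mul_apply, Equiv.Perm.mul_apply, simpleTransposition_apply_cast] at h2
    exact ⟨(simpleTransposition_lt_iff h' j).2 h1, h2⟩
  · rintro ⟨h1, h2⟩
    refine ⟨simpleTransposition k p j, ⟨(simpleTransposition_lt_iff h' j).2 h1, ?_⟩,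
      simpleTransposition_apply_apply _ j⟩
    rw [Equiv.Perm.mul_apply, Equiv.Perm.mul_apply, simpleTransposition_apply_cast,
      simpleTransposition_apply_apply]
    exact h2

theorem inversions_add_one_of_lt {x : Equiv.Perm ℤ} {p : ℤ} (h : x p < x (p + 1)) :
    inversions x (p + 1) = {j | j < p ∧ x (p + 1) < x j} := by
  ext j
  constructor
  · rintro ⟨h1, h2⟩
    refine ⟨lt_of_le_of_ne (by omega) ?_, h2⟩
    rintro rfl
    exact lt_asymm h h2
  · rintro ⟨h1, h2⟩
    exact ⟨by omega, h2⟩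

theorem ncard_inversions_mul_of_lt {x : Equiv.Perm ℤ} {p : ℤ} (h : x p < x (p + 1)) :
    (inversions (x * simpleTransposition k (p : ZMod (k + 1))) p).ncard =
      (inversions x (p + 1)).ncard := by
  rw [← Set.ncard_image_of_injective _ (simpleTransposition k (p : ZMod (k + 1))).injective,
    image_inversions_mul, inversions_add_one_of_lt h]

/-- The inversion that disappears is the pair `(p, p + 1)` itself. -/
theorem ncard_inversions_mul_of_gt {x : Equiv.Perm ℤ} (hx : IsPeriodic k x) {p : ℤ}
    (h : x (p + 1) < x p) :
    (inversions (x * simpleTransposition k (p : ZMod (k + 1))) p).ncard + 1 =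
      (inversions x (p + 1)).ncard := by
  rw [← Set.ncard_image_of_injective _ (simpleTransposition k (p : ZMod (k + 1))).injective,
    image_inversions_mul]
  have : inversions x (p + 1) = insert p {j | j < p ∧ x (p + 1) < x j} := by
    ext j
    rw [Set.mem_insert_iff]
    constructor
    · rintro ⟨h1, h2⟩
      rcases eq_or_ne j p with rfl | h3
      · exact Or.inl rfl
      · exact Or.inr ⟨by omega, h2⟩
    · rintro (rfl | ⟨h1, h2⟩)
      · exact ⟨by omega, h⟩
      · exact ⟨by omega, h2⟩
  rw [this, Set.ncard_insert_of_notMem (fun h => lt_irrefl _ h.1)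
    ((hx.finite_inversions (p + 1)).subset fun j hj => ⟨by linarith [hj.1], hj.2⟩)]

/-- The effect on codes of the right multiplication by `s_i`. -/
def codeStep (i : ZMod (k + 1)) (c : ZMod (k + 1) → ℕ) (a : ZMod (k + 1)) : ℕ :=
  if a = i then (if c i < c (i + 1) then c (i + 1) - 1 else c (i + 1))
  else if a = i + 1 then (if c i < c (i + 1) then c i else c i + 1)
  else c a

/-- The code alone tells whether `x` descends at `p`: the descents are exactly the places where the
code increases strictly. -/
theorem IsPeriodic.code_mul_simpleTransposition {x : Equiv.Perm ℤ} (hx : IsPeriodic k x)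
    (i : ZMod (k + 1)) : code k (x * simpleTransposition k i) = codeStep i (code k x) := by
  obtain ⟨p, rfl⟩ : ∃ p : ℤ, (p : ZMod (k + 1)) = i := ⟨_, cast_val i⟩
  have hy := hx.mul (isPeriodic_simpleTransposition (p : ZMod (k + 1)))
  have hp : (p : ZMod (k + 1)) + 1 = ((p + 1 : ℤ) : ZMod (k + 1)) := by push_cast; rfl
  have hxp : x * simpleTransposition k (p : ZMod (k + 1)) *
      simpleTransposition k (p : ZMod (k + 1)) = x := by
    rw [mul_assoc, simpleTransposition_mul_self, mul_one]
  have h1 : (x * simpleTransposition k (p : ZMod (k + 1))) p = x (p + 1) := by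
    rw [Equiv.Perm.mul_apply, simpleTransposition_apply_cast]
  have h2 : (x * simpleTransposition k (p : ZMod (k + 1))) (p + 1) = x p := by
    rw [Equiv.Perm.mul_apply, simpleTransposition_apply_cast_add_one]
  -- Without a descent at `p`, every inversion at `p + 1` is also one at `p`.
  have hle : ∀ {z : Equiv.Perm ℤ}, IsPeriodic k z → z p < z (p + 1) →
      (inversions z (p + 1)).ncard ≤ (inversions z p).ncard := by
    intro z hz h
    rw [inversions_add_one_of_lt h]
    exact Set.ncard_le_ncard (fun j hj => ⟨hj.1, h.trans hj.2⟩) (hz.finite_inversions p)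
  funext a
  obtain ⟨m, rfl⟩ : ∃ m : ℤ, (m : ZMod (k + 1)) = a := ⟨_, cast_val a⟩
  have hne : x p ≠ x (p + 1) := fun h => by
    have := x.injective h
    omega
  rw [codeStep]
  rcases lt_or_gt_of_ne hne with h | h
  · have h3 := ncard_inversions_mul_of_lt (k := k) h
    -- `x * s_p` descends at `p`, and a second multiplication by `s_p` returns to `x`.
    have h4 := ncard_inversions_mul_of_gt (p := p) hy (by rwa [h1, h2])
    rw [hxp] at h4
    have h5 := hle hx h
    have h6 : ¬ code k x (p : ZMod (k + 1)) < code k x ((p : ZMod (k + 1)) + 1) := by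
      rw [hp, hx.code_cast, hx.code_cast]
      omega
    rw [if_neg h6, if_neg h6]
    split_ifs with ha hb
    · rw [ha, hp, hy.code_cast, hx.code_cast, h3]
    · rw [hb, hp, hy.code_cast, hx.code_cast, h4]
    · rw [hy.code_cast, hx.code_cast, ncard_inversions_mul_of_ne ha hb]
  · have h3 := ncard_inversions_mul_of_gt hx h
    have hlt : (x * simpleTransposition k (p : ZMod (k + 1))) p <
        (x * simpleTransposition k (p : ZMod (k + 1))) (p + 1) := by rwa [h1, h2]
    have h4 := ncard_inversions_mul_of_lt (k := k) hlt
    rw [hxp] at h4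
    have h5 := hle hy hlt
    have h6 : code k x (p : ZMod (k + 1)) < code k x ((p : ZMod (k + 1)) + 1) := by
      rw [hp, hx.code_cast, hx.code_cast]
      omega
    rw [if_pos h6, if_pos h6]
    split_ifs with ha hb
    · rw [ha, hp, hy.code_cast, hx.code_cast, ← h3, Nat.add_sub_cancel]
    · rw [hb, hp, hy.code_cast, hx.code_cast, h4]
    · rw [hy.code_cast, hx.code_cast, ncard_inversions_mul_of_ne ha hb]

/-! ### Products of words -/

theorem isPeriodic_wordProd (w : List (ZMod (k + 1))) : IsPeriodic k (wordProd k w) := by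
  induction w with
  | nil => exact IsPeriodic.one
  | cons i w ih =>
    rw [wordProd, List.map_cons, List.prod_cons]
    exact (isPeriodic_simpleTransposition i).mul ih

theorem wordProd_nil : wordProd k [] = 1 := rfl

theorem wordProd_cons (i : ZMod (k + 1)) (w : List (ZMod (k + 1))) :
    wordProd k (i :: w) = simpleTransposition k i * wordProd k w := by
  rw [wordProd, List.map_cons, List.prod_cons, wordProd]

theorem wordProd_append (v w : List (ZMod (k + 1))) :
    wordProd k (v ++ w) = wordProd k v * wordProd k w := by
  rw [wordProd, List.map_append, List.prod_append, wordProd, wordProd]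

theorem wordProd_reverse (w : List (ZMod (k + 1))) :
    wordProd k w.reverse = (wordProd k w)⁻¹ := by
  induction w with
  | nil => simp [wordProd_nil]
  | cons i w ih =>
    rw [List.reverse_cons, wordProd_append, ih, wordProd_cons, wordProd_cons, wordProd_nil,
      mul_one, mul_inv_rev, simpleTransposition_inv]

/-- The last letter of `w` comes first in the inverse, hence the right fold. -/
theorem IsPeriodic.code_mul_wordProd_inv {x : Equiv.Perm ℤ} (hx : IsPeriodic k x)
    (w : List (ZMod (k + 1))) :
    code k (x * (wordProd k w)⁻¹) = w.foldr codeStep (code k x) := by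
  induction w with
  | nil => simp [wordProd_nil]
  | cons i w ih =>
    have := hx.mul (isPeriodic_wordProd w.reverse)
    rw [wordProd_reverse] at this
    rw [wordProd_cons, mul_inv_rev, ← mul_assoc, simpleTransposition_inv,
      this.code_mul_simpleTransposition, ih, List.foldr_cons]

theorem IsAffine.mul_simpleTransposition {x : Equiv.Perm ℤ} (hx : IsAffine k x)
    (i : ZMod (k + 1)) : IsAffine k (x * simpleTransposition k i) := by
  refine ⟨hx.isPeriodic.mul (isPeriodic_simpleTransposition i), ?_⟩
  -- The displacements are permuted, apart from a `+1` at `i` and a `-1` at `i + 1`, which cancel in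
  -- the sum.
  have h : ∀ a : ZMod (k + 1), displacement (x * simpleTransposition k i) a =
      displacement x (Equiv.swap i (i + 1) a) +
        ((if a = i then 1 else 0) - (if a = i + 1 then 1 else 0)) := by
    intro a
    obtain ⟨m, rfl⟩ : ∃ m : ℤ, (m : ZMod (k + 1)) = a := ⟨_, cast_val a⟩
    rw [(hx.isPeriodic.mul (isPeriodic_simpleTransposition i)).displacement_cast,
      Equiv.Perm.mul_apply, simpleTransposition_apply, Equiv.swap_apply_def]
    have h1 : i ≠ i + 1 := by simpa using zmod_one_ne_zero (k := k)
    split_ifs with h2 h3 h3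
    · exact absurd (h2.symm.trans h3) h1
    · rw [← h2]
      have := hx.isPeriodic.displacement_cast (m + 1)
      push_cast at this
      rw [this]
      ring
    · have : i = ((m - 1 : ℤ) : ZMod (k + 1)) := by push_cast; rw [h3]; ring
      rw [this, hx.isPeriodic.displacement_cast]
      ring
    · rw [hx.isPeriodic.displacement_cast]
      ring
  rw [Finset.sum_congr rfl fun a _ => h a, Finset.sum_add_distrib,
    Equiv.sum_comp (Equiv.swap i (i + 1)) (displacement x), hx.sum_displacement]
  simp

theorem IsAffine.mul_wordProd {x : Equiv.Perm ℤ} (hx : IsAffine k x)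
    (w : List (ZMod (k + 1))) : IsAffine k (x * wordProd k w) := by
  induction w generalizing x with
  | nil => simpa [wordProd_nil] using hx
  | cons i w ih =>
    rw [wordProd_cons, ← mul_assoc]
    exact ih (hx.mul_simpleTransposition i)

theorem isAffine_wordProd (w : List (ZMod (k + 1))) : IsAffine k (wordProd k w) := by
  simpa using isAffine_one.mul_wordProd w

end simple

/-! ### The sum of the code as a length function -/

section codes

variable {k : ℕ}

theorem ne_add_one [NeZero k] (i : ZMod (k + 1)) : i ≠ i + 1 := by
  simpa using zmod_one_ne_zero (k := k)

theorem sum_codeStep [NeZero k] (i : ZMod (k + 1)) (c : ZMod (k + 1) → ℕ) :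
    (c i < c (i + 1) ∧ ∑ a, codeStep i c a + 1 = ∑ a, c a) ∨
      (¬ c i < c (i + 1) ∧ ∑ a, codeStep i c a = ∑ a, c a + 1) := by
  have hne := ne_add_one i
  have key : ∀ f : ZMod (k + 1) → ℕ,
      ∑ a, f a = f i + f (i + 1) + ∑ a ∈ (Finset.univ.erase i).erase (i + 1), f a := by
    intro f
    rw [add_assoc, Finset.add_sum_erase _ _ (by simp [hne.symm]),
      Finset.add_sum_erase _ _ (Finset.mem_univ i)]
  have hrest : ∑ a ∈ (Finset.univ.erase i).erase (i + 1), codeStep i c a =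
      ∑ a ∈ (Finset.univ.erase i).erase (i + 1), c a := by
    refine Finset.sum_congr rfl fun a ha => ?_
    simp only [Finset.mem_erase, Finset.mem_univ, and_true] at ha
    rw [codeStep, if_neg ha.2, if_neg ha.1]
  have h1 : codeStep i c i = if c i < c (i + 1) then c (i + 1) - 1 else c (i + 1) := by
    rw [codeStep, if_pos rfl]
  have h2 : codeStep i c (i + 1) = if c i < c (i + 1) then c i else c i + 1 := by
    rw [codeStep, if_neg hne.symm, if_pos rfl]
  rw [key (codeStep i c), key c, hrest, h1, h2]
  by_cases h : c i < c (i + 1)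
  · left
    rw [if_pos h, if_pos h]
    exact ⟨h, by omega⟩
  · right
    rw [if_neg h, if_neg h]
    exact ⟨h, by omega⟩

theorem sum_le_sum_foldr_codeStep [NeZero k] (w : List (ZMod (k + 1))) (c : ZMod (k + 1) → ℕ) :
    ∑ a, c a ≤ ∑ a, w.foldr codeStep c a + w.length := by
  induction w with
  | nil => simp
  | cons i w ih =>
    rw [List.foldr_cons, List.length_cons]
    rcases sum_codeStep i (w.foldr codeStep c) with ⟨_, h⟩ | ⟨_, h⟩ <;> omega

/-- The word must bring its own code down to zero, and each letter lowers the sum by at most one. -/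
theorem sum_code_le_length [NeZero k] (w : List (ZMod (k + 1))) :
    ∑ a, code k (wordProd k w) a ≤ w.length := by
  have h := sum_le_sum_foldr_codeStep w (code k (wordProd k w))
  rw [← (isPeriodic_wordProd w).code_mul_wordProd_inv, mul_inv_cancel, code_one] at h
  simpa using h

/-- Every letter of `w` acts as a descent when `w` acts on the code `c` from the right. -/
def ActsByDescents (c : ZMod (k + 1) → ℕ) (w : List (ZMod (k + 1))) : Prop :=
  ∀ i v, (i :: v) <:+ w → v.foldr codeStep c i < v.foldr codeStep c (i + 1)

/-- If the total drop equals the number of letters, no letter can raise the sum. -/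
theorem actsByDescents_of_sum_eq [NeZero k] {c : ZMod (k + 1) → ℕ} {w : List (ZMod (k + 1))}
    (h : ∑ a, w.foldr codeStep c a + w.length = ∑ a, c a) : ActsByDescents c w := by
  rintro i v ⟨u, rfl⟩
  have h1 := sum_le_sum_foldr_codeStep v c
  have h2 := sum_le_sum_foldr_codeStep u ((i :: v).foldr codeStep c)
  rw [List.foldr_append] at h
  simp only [List.length_append, List.length_cons, List.foldr_cons] at h h1 h2
  rcases sum_codeStep i (v.foldr codeStep c) with ⟨h3, _⟩ | ⟨_, h3⟩
  · exact h3
  · omega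

theorem ActsByDescents.sum_eq [NeZero k] {c : ZMod (k + 1) → ℕ} {w : List (ZMod (k + 1))}
    (h : ActsByDescents c w) : ∑ a, w.foldr codeStep c a + w.length = ∑ a, c a := by
  induction w with
  | nil => simp
  | cons i w ih =>
    have h1 := ih fun j v hv => h j v (hv.trans (List.suffix_cons i w))
    have h2 := h i w List.suffix_rfl
    rw [List.foldr_cons, List.length_cons]
    rcases sum_codeStep i (w.foldr codeStep c) with ⟨_, h3⟩ | ⟨h3, _⟩
    · omega
    · exact absurd h2 h3

theorem foldr_codeStep_of_notMem {c : ZMod (k + 1) → ℕ} {v : List (ZMod (k + 1))}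
    {a : ZMod (k + 1)} (h : a ∉ v) (h' : a - 1 ∉ v) : v.foldr codeStep c a = c a := by
  induction v with
  | nil => rfl
  | cons i v ih =>
    rw [List.mem_cons, not_or] at h h'
    rw [List.foldr_cons, codeStep, if_neg h.1, if_neg (fun h1 => h'.1 (by rw [h1]; ring)),
      ih h.2 h'.2]

/-! ### Cyclically decreasing words acting on a code -/

theorem IsCyclicWord.of_suffix [NeZero k] {A : Finset (ZMod (k + 1))} {w v : List (ZMod (k + 1))}
    {i : ZMod (k + 1)} (hw : IsCyclicWord .decreasing A w) (h : (i :: v) <:+ w) :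
    i ∈ A ∧ i ∉ v ∧ i + 1 ∉ v ∧ (i - 1 ∈ A → i - 1 ∈ v) := by
  obtain ⟨u, rfl⟩ := h
  obtain ⟨hnd, hA, hord⟩ := hw
  have hmem : ∀ a, a ∈ A ↔ a ∈ u ∨ a = i ∨ a ∈ v := by
    intro a
    rw [← hA, List.mem_toFinset, List.mem_append, List.mem_cons]
  have hi : i ∈ A := (hmem i).2 (Or.inr (Or.inl rfl))
  rw [List.nodup_append] at hnd
  obtain ⟨-, hnd2, hdisj⟩ := hnd
  rw [List.nodup_cons] at hnd2
  have hiu : i ∉ u := fun h => hdisj i h i List.mem_cons_self rfl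
  have hidx : (u ++ i :: v).idxOf i = u.length := by
    rw [List.idxOf_append_of_notMem hiu, List.idxOf_cons_self, add_zero]
  refine ⟨hi, hnd2.1, fun h => ?_, fun h => ?_⟩
  · have h1 : i + 1 ∉ u := fun h' => hdisj _ h' _ (List.mem_cons_of_mem _ h) rfl
    have := hord (i + 1) ((hmem _).2 (Or.inr (Or.inr h))) (by rwa [add_sub_cancel_right])
    rw [add_sub_cancel_right, hidx, List.idxOf_append_of_notMem h1] at this
    omega
  · rcases (hmem _).1 h with h1 | h1 | h1
    · have := hord i hi h
      rw [hidx] at this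
      have h2 := List.idxOf_lt_length_of_mem h1
      rw [← List.idxOf_append_of_mem (l₂ := i :: v) h1] at h2
      omega
    · exact absurd (h1.trans (sub_add_cancel i 1).symm) (ne_add_one (i - 1))
    · exact h1

/-- The residues `a` in row `j + 1` of the diagram of `c`, the box in column `i` and row `j + 1`
being marked with `i - (j + 1)`. -/
def codeRow (c : ZMod (k + 1) → ℕ) (j : ℕ) : Finset (ZMod (k + 1)) :=
  Finset.univ.filter fun a => j < c (a + (j + 1))

theorem mem_codeRow_zero {c : ZMod (k + 1) → ℕ} {a : ZMod (k + 1)} :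
    a ∈ codeRow c 0 ↔ 0 < c (a + 1) := by
  simp [codeRow]

/-- The code that is left when the first row is removed. -/
def codeTail (c : ZMod (k + 1) → ℕ) (a : ZMod (k + 1)) : ℕ := c (a + 1) - 1

theorem codeRow_codeTail (c : ZMod (k + 1) → ℕ) (j : ℕ) :
    codeRow (codeTail c) j = codeRow c (j + 1) := by
  ext a
  simp only [codeRow, Finset.mem_filter, Finset.mem_univ, true_and]
  rw [codeTail, show a + ((j : ZMod (k + 1)) + 1) + 1 = a + (((j + 1 : ℕ) : ZMod (k + 1)) + 1) by
    push_cast; ring]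
  omega

/-- When `i` acts, neither `i` nor `i + 1` has acted, so the entry at `i + 1` is still `c (i + 1)`.
A descent there makes it positive. -/
theorem IsCyclicWord.subset_codeRow [NeZero k] {c : ZMod (k + 1) → ℕ} {A : Finset (ZMod (k + 1))}
    {w : List (ZMod (k + 1))} (hw : IsCyclicWord .decreasing A w) (h : ActsByDescents c w) :
    A ⊆ codeRow c 0 := by
  intro i hi
  rw [← hw.2.1, List.mem_toFinset] at hi
  obtain ⟨u, v, huv⟩ := List.append_of_mem hi
  have hs : (i :: v) <:+ w := ⟨u, huv.symm⟩
  obtain ⟨-, h1, h2, -⟩ := hw.of_suffix hs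
  have h3 := h i v hs
  rw [foldr_codeStep_of_notMem h2 (by rwa [add_sub_cancel_right])] at h3
  exact mem_codeRow_zero.2 (by omega)

/-- The invariant is that each letter `i` finds a zero at `i`: the letter `i - 1` left it there, or
`c i` was zero from the start. The letter moves this zero to `i + 1` and brings `c (i + 1) - 1` to
`i`. -/
theorem IsCyclicWord.foldr_codeStep_suffix [NeZero k] {c : ZMod (k + 1) → ℕ} {w v : List (ZMod (k + 1))}
    (hw : IsCyclicWord .decreasing (codeRow c 0) w) (hv : v <:+ w) (a : ZMod (k + 1)) :
    v.foldr codeStep c a = if a ∈ v then c (a + 1) - 1 else if a - 1 ∈ v then 0 else c a := by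
  induction v generalizing a with
  | nil => simp
  | cons i v ih =>
    have ih := ih ((List.suffix_cons i v).trans hv)
    obtain ⟨h1, h2, h3, h4⟩ := hw.of_suffix hv
    have hi : v.foldr codeStep c i = 0 := by
      rw [ih, if_neg h2]
      split_ifs with h5
      · rfl
      · have := mt h4 h5
        rw [mem_codeRow_zero, sub_add_cancel] at this
        omega
    have hi1 : v.foldr codeStep c (i + 1) = c (i + 1) := by
      rw [ih, if_neg h3, add_sub_cancel_right, if_neg h2]
    have hpos := mem_codeRow_zero.1 h1
    rw [List.foldr_cons, codeStep, hi, hi1, if_pos hpos, if_pos hpos, ih]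
    simp only [List.mem_cons]
    by_cases ha : a = i
    · simp [ha]
    · by_cases hb : a = i + 1
      · subst hb
        rw [if_neg ha, if_pos rfl, if_neg (by simp [ha, h3]), if_pos (by simp)]
      · have hb' : a - 1 ≠ i := fun h => hb (by rw [← h]; ring)
        simp [ha, hb, hb']

theorem IsCyclicWord.actsByDescents [NeZero k] {c : ZMod (k + 1) → ℕ} {w : List (ZMod (k + 1))}
    (hw : IsCyclicWord .decreasing (codeRow c 0) w) : ActsByDescents c w := by
  intro i v hv
  have hv' := (List.suffix_cons i v).trans hv
  obtain ⟨h1, h2, h3, h4⟩ := hw.of_suffix hv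
  rw [hw.foldr_codeStep_suffix hv', hw.foldr_codeStep_suffix hv', if_neg h2, if_neg h3,
    add_sub_cancel_right, if_neg h2]
  have hpos := mem_codeRow_zero.1 h1
  split_ifs with h5
  · exact hpos
  · have := mt h4 h5
    rw [mem_codeRow_zero, sub_add_cancel] at this
    omega

theorem IsCyclicWord.foldr_codeStep [NeZero k] {c : ZMod (k + 1) → ℕ} {w : List (ZMod (k + 1))}
    (hw : IsCyclicWord .decreasing (codeRow c 0) w) : w.foldr codeStep c = codeTail c := by
  funext a
  have hmem : ∀ b, b ∈ w ↔ 0 < c (b + 1) := fun b => by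
    rw [← mem_codeRow_zero, ← hw.2.1, List.mem_toFinset]
  rw [hw.foldr_codeStep_suffix List.suffix_rfl, codeTail]
  simp only [hmem, sub_add_cancel]
  -- Truncated subtraction is what is wanted: an empty column stays empty.
  split_ifs <;> omega

/-- Cutting the cycle at the missing residue `z` orders the others linearly by `(a - z).val`; the
word lists `A` from the largest to the smallest. -/
theorem exists_isCyclicWord [NeZero k] {A : Finset (ZMod (k + 1))} {z : ZMod (k + 1)} (hz : z ∉ A) :
    ∃ w, IsCyclicWord .decreasing A w := by
  have hval : ∀ j : ZMod (k + 1), j ≠ z → (j - 1 - z).val < (j - z).val := by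
    intro j hj
    have h1 : (j - z).val ≠ 0 := by
      rw [Ne, ZMod.val_eq_zero, sub_eq_zero]
      exact hj
    have h2 : j - 1 - z = (((j - z).val - 1 : ℕ) : ZMod (k + 1)) := by
      rw [Nat.cast_sub (by omega), ZMod.natCast_zmod_val]
      push_cast
      ring
    rw [h2]
    rw [ZMod.val_natCast]
    exact (Nat.mod_le _ _).trans_lt (by omega)
  induction A using Finset.induction_on_max_value (fun a => (a - z).val) with
  | empty => exact ⟨[], List.nodup_nil, rfl, fun j hj => absurd hj (Finset.notMem_empty j)⟩
  | insert a s ha hmax ih =>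
    rw [Finset.mem_insert, not_or] at hz
    obtain ⟨w, hnd, hs, hord⟩ := ih hz.2
    have haw : a ∉ w := by rwa [← List.mem_toFinset, hs]
    refine ⟨a :: w, List.nodup_cons.2 ⟨haw, hnd⟩, by rw [List.toFinset_cons, hs], ?_⟩
    intro j hj hj'
    rw [Finset.mem_insert] at hj hj'
    have hne : j - 1 ≠ j := fun h => ne_add_one (j - 1) (by rw [sub_add_cancel, h])
    rcases hj with rfl | hj
    · simp only [List.idxOf_cons_self]
      rw [List.idxOf_cons_ne _ hne.symm]
      omega
    · have hja : j ≠ a := fun h => ha (h ▸ hj)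
      rcases hj' with hj' | hj'
      · have h1 := hmax j hj
        have h2 := hval j (fun h => hz.2 (h ▸ hj))
        rw [hj'] at h2
        omega
      · have hja' : j - 1 ≠ a := fun h => ha (h ▸ hj')
        simp only
        rw [List.idxOf_cons_ne _ hja.symm, List.idxOf_cons_ne _ hja'.symm]
        have := hord j hj hj'
        simp only at this
        omega

/-! ### The greedy decomposition and its maximality -/

/-- The nonempty rows of the diagram of `c`. -/
def codeRows (c : ZMod (k + 1) → ℕ) : List (Finset (ZMod (k + 1))) :=
  (List.range (Finset.univ.sup c)).map (codeRow c)

theorem sup_codeTail (c : ZMod (k + 1) → ℕ) :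
    Finset.univ.sup (codeTail c) = Finset.univ.sup c - 1 := by
  refine le_antisymm (Finset.sup_le fun a _ => ?_) ?_
  · exact Nat.sub_le_sub_right (Finset.le_sup (Finset.mem_univ (a + 1))) 1
  · rw [Nat.sub_le_iff_le_add]
    refine Finset.sup_le fun a _ => ?_
    have := Finset.le_sup (f := codeTail c) (Finset.mem_univ (a - 1))
    rw [codeTail, sub_add_cancel] at this
    omega

theorem codeRows_of_sup_eq_zero {c : ZMod (k + 1) → ℕ} (h : Finset.univ.sup c = 0) :
    codeRows c = [] := by
  rw [codeRows, h, List.range_zero, List.map_nil]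

theorem codeRows_of_sup_pos {c : ZMod (k + 1) → ℕ} (h : 0 < Finset.univ.sup c) :
    codeRows c = codeRow c 0 :: codeRows (codeTail c) := by
  obtain ⟨m, hm⟩ := Nat.exists_eq_add_of_lt h
  rw [zero_add] at hm
  rw [codeRows, codeRows, sup_codeTail, hm, Nat.add_sub_cancel, List.range_succ_eq_map,
    List.map_cons, List.map_map]
  congr 1
  exact List.map_congr_left fun j _ => (codeRow_codeTail c j).symm

theorem getD_codeRows (c : ZMod (k + 1) → ℕ) (j : ℕ) : (codeRows c).getD j ∅ = codeRow c j := by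
  rw [codeRows, List.getD_eq_getElem?_getD, List.getElem?_map]
  by_cases h : j < Finset.univ.sup c
  · rw [List.getElem?_range h]
    rfl
  · rw [List.getElem?_eq_none (by simpa using h)]
    refine (Finset.filter_eq_empty_iff.2 fun a _ => ?_).symm
    have := Finset.le_sup (f := c) (Finset.mem_univ (a + (j + 1)))
    omega

theorem sup_pos_iff {c : ZMod (k + 1) → ℕ} : 0 < Finset.univ.sup c ↔ ∃ a, 0 < c a := by
  simp [Finset.lt_sup_iff]

/-- The rows of the code of `x` are the factors of a decomposition of `x` into cyclically decreasing
elements whose length is the sum of the code. -/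
theorem IsAffine.exists_words [NeZero k] {x : Equiv.Perm ℤ} (hx : IsAffine k x) :
    (∀ S ∈ codeRows (code k x), S.Nonempty ∧ S ≠ Finset.univ) ∧
    ∃ ws : List (List (ZMod (k + 1))),
      List.Forall₂ (IsCyclicWord .decreasing) (codeRows (code k x)) ws ∧
        wordProd k ws.reverse.flatten = x ∧
        ws.reverse.flatten.length = ∑ a, code k x a := by
  -- Induction on the number of nonempty rows.
  induction hn : Finset.univ.sup (code k x) generalizing x with
  | zero =>
    have h0 : code k x = 0 := by
      funext a
      have := Finset.le_sup (f := code k x) (Finset.mem_univ a)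
      rw [hn] at this
      exact Nat.le_zero.1 this
    rw [codeRows_of_sup_eq_zero hn]
    refine ⟨by simp, [], List.Forall₂.nil, ?_, ?_⟩
    · rw [hx.eq_one_of_code_eq_zero h0]
      rfl
    · rw [h0]
      simp
  | succ n ih =>
    have hpos : 0 < Finset.univ.sup (code k x) := by omega
    obtain ⟨b, hb⟩ := hx.isPeriodic.exists_code_eq_zero
    -- A zero of the code makes the first row a proper subset, so that it has a cyclic word.
    have hb' : b - 1 ∉ codeRow (code k x) 0 := by
      rw [mem_codeRow_zero, sub_add_cancel]
      omega
    obtain ⟨w, hw⟩ := exists_isCyclicWord hb'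
    have hy : IsAffine k (x * (wordProd k w)⁻¹) := by
      rw [← wordProd_reverse]
      exact hx.mul_wordProd _
    have hcode : code k (x * (wordProd k w)⁻¹) = codeTail (code k x) := by
      rw [hx.isPeriodic.code_mul_wordProd_inv, hw.foldr_codeStep]
    obtain ⟨h1, ws, h2, h3, h4⟩ := ih hy (by rw [hcode, sup_codeTail, hn, Nat.add_sub_cancel])
    rw [hcode] at h1 h2 h4
    rw [codeRows_of_sup_pos hpos]
    refine ⟨?_, w :: ws, List.Forall₂.cons hw h2, ?_, ?_⟩
    · rintro S hS
      rcases List.mem_cons.1 hS with rfl | hS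
      · obtain ⟨a, ha⟩ := sup_pos_iff.1 hpos
        refine ⟨⟨a - 1, ?_⟩, fun h => hb' (h ▸ Finset.mem_univ _)⟩
        rwa [mem_codeRow_zero, sub_add_cancel]
      · exact h1 S hS
    · rw [List.reverse_cons, List.flatten_append, wordProd_append, h3]
      simp
    · rw [List.reverse_cons, List.flatten_append, List.length_append, h4,
        ← hw.actsByDescents.sum_eq, hw.foldr_codeStep]
      simp

/-- The greedy word attains the lower bound `sum_code_le_length`. -/
theorem IsAffine.isReducedWord_iff [NeZero k] {x : Equiv.Perm ℤ} (hx : IsAffine k x)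
    (w : List (ZMod (k + 1))) :
    IsReducedWord w x ↔ wordProd k w = x ∧ w.length = ∑ a, code k x a := by
  refine and_congr_right fun h => ⟨fun hmin => ?_, fun hlen v hv => ?_⟩
  · obtain ⟨-, ws, -, h1, h2⟩ := hx.exists_words
    refine le_antisymm (h2 ▸ hmin _ h1) ?_
    rw [← h]
    exact sum_code_le_length w
  · rw [hlen, ← hv]
    exact sum_code_le_length v

theorem IsAffine.isDecomposition_codeRows [NeZero k] {x : Equiv.Perm ℤ} (hx : IsAffine k x) :
    IsDecomposition .decreasing x (codeRows (code k x)) := by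
  obtain ⟨h1, ws, h2, h3⟩ := hx.exists_words
  exact ⟨h1, ws, h2, (hx.isReducedWord_iff _).2 h3⟩

theorem IsAffine.exists_wordProd_eq [NeZero k] {x : Equiv.Perm ℤ} (hx : IsAffine k x) :
    ∃ w, wordProd k w = x := by
  obtain ⟨-, ws, -, h, -⟩ := hx.exists_words
  exact ⟨_, h⟩

theorem map_card_le_codeRows [NeZero k] {B : List (Finset (ZMod (k + 1)))}
    {ws : List (List (ZMod (k + 1)))} (hB : ∀ S ∈ B, S.Nonempty)
    (hws : List.Forall₂ (IsCyclicWord .decreasing) B ws)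
    (hlen : ws.reverse.flatten.length = ∑ a, code k (wordProd k ws.reverse.flatten) a) :
    B.map Finset.card ≤ (codeRows (code k (wordProd k ws.reverse.flatten))).map Finset.card ∧
      (B.map Finset.card =
          (codeRows (code k (wordProd k ws.reverse.flatten))).map Finset.card →
        B = codeRows (code k (wordProd k ws.reverse.flatten))) := by
  induction hws with
  | nil =>
    refine ⟨not_lt.1 List.not_lex_nil, fun h => ?_⟩
    rw [List.map_nil, eq_comm, List.map_eq_nil_iff] at h
    exact h.symm
  | @cons b w B ws hw hws ih =>
    set c := code k (wordProd k (w :: ws).reverse.flatten) with hc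
    have hprod : wordProd k (w :: ws).reverse.flatten =
        wordProd k ws.reverse.flatten * wordProd k w := by
      rw [List.reverse_cons, List.flatten_append, wordProd_append]
      simp
    have hlen' : (w :: ws).reverse.flatten.length = ws.reverse.flatten.length + w.length := by
      rw [List.reverse_cons, List.flatten_append, List.length_append]
      simp
    have hy : code k (wordProd k ws.reverse.flatten) = w.foldr codeStep c := by
      rw [hc, ← (isPeriodic_wordProd _).code_mul_wordProd_inv, hprod, mul_inv_cancel_right]
    have h1 := sum_code_le_length ws.reverse.flatten
    have h2 := sum_le_sum_foldr_codeStep w c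
    rw [← hy] at h2
    -- The length bounds for the first factor and for the remaining product add up to an equality,
    -- so both are equalities.
    have hdesc : ActsByDescents c w := actsByDescents_of_sum_eq (by rw [← hy]; omega)
    have hsub := hw.subset_codeRow hdesc
    obtain ⟨a, ha⟩ := hB b List.mem_cons_self
    have hpos : 0 < Finset.univ.sup c := sup_pos_iff.2 ⟨_, mem_codeRow_zero.1 (hsub ha)⟩
    rw [codeRows_of_sup_pos hpos, List.map_cons, List.map_cons]
    -- If the first factor is the full row, the comparison passes to the tail; a proper subset
    -- already loses at the first entry.
    by_cases hb : b = codeRow c 0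
    · subst hb
      rw [hw.foldr_codeStep] at hy
      have ih := ih (fun S hS => hB S (List.mem_cons_of_mem _ hS)) (by omega)
      rw [hy] at ih
      refine ⟨List.cons_le_cons _ ih.1, fun h => ?_⟩
      rw [List.cons.injEq] at h
      rw [← ih.2 h.2]
    · have hlt := Finset.card_lt_card (hsub.ssubset_of_ne hb)
      refine ⟨le_of_lt (List.Lex.rel hlt), fun h => ?_⟩
      rw [List.cons.injEq] at h
      omega

theorem IsAffine.isMaximalRight_iff [NeZero k] {x : Equiv.Perm ℤ} (hx : IsAffine k x)
    (B : List (Finset (ZMod (k + 1)))) :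
    IsMaximalRight .decreasing x B ↔ B = codeRows (code k x) := by
  have key : ∀ B, IsDecomposition .decreasing x B →
      B.map Finset.card ≤ (codeRows (code k x)).map Finset.card ∧
        (B.map Finset.card = (codeRows (code k x)).map Finset.card →
          B = codeRows (code k x)) := by
    rintro B ⟨hB, ws, hws, hred⟩
    obtain ⟨rfl, hlen⟩ := (hx.isReducedWord_iff _).1 hred
    exact map_card_le_codeRows (fun S hS => (hB S hS).1) hws hlen
  constructor
  · rintro ⟨hB, hmax⟩
    exact (key B hB).2 (le_antisymm (key B hB).1 (hmax _ hx.isDecomposition_codeRows))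
  · rintro rfl
    exact ⟨hx.isDecomposition_codeRows, fun B hB => (key B hB).1⟩

/-! ### The code `RD` -/

theorem rowSub_succ (α : KCode k) (j : ℕ) : rowSub α (j + 1) = codeRow α j := by
  ext a
  simp only [rowSub, codeRow, Finset.mem_image, Finset.mem_filter, Finset.mem_univ, true_and]
  push_cast
  constructor
  · rintro ⟨i, hi, rfl⟩
    rw [sub_add_cancel]
    omega
  · intro h
    exact ⟨a + (j + 1), h, by ring⟩

/-- Column `a` meets row `j` in the residue `a - (j + 1)`, so the rows recover every column height.
-/
theorem codeRow_injective {c c' : ZMod (k + 1) → ℕ} (h : ∀ j, codeRow c j = codeRow c' j) :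
    c = c' := by
  have key : ∀ j a, j < c a ↔ j < c' a := by
    intro j a
    have := Finset.ext_iff.1 (h j) (a - (j + 1))
    simpa [codeRow] using this
  funext a
  have h1 := key (c a) a
  have h2 := key (c' a) a
  omega

theorem IsAffine.isRD_iff [NeZero k] {x : Equiv.Perm ℤ} (hx : IsAffine k x) (α : KCode k) :
    IsRD x α ↔ (α : ZMod (k + 1) → ℕ) = code k x := by
  constructor
  · rintro ⟨A, hA, hrow⟩
    obtain rfl : A = codeRows (code k x) := (hx.isMaximalRight_iff A).1 ((hA A).2 rfl)
    refine codeRow_injective fun j => ?_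
    rw [← rowSub_succ, ← hrow, getD_codeRows]
  · intro h
    refine ⟨_, hx.isMaximalRight_iff, fun j => ?_⟩
    rw [getD_codeRows, rowSub_succ, h]

theorem KCode.ext {α β : KCode k} (h : (α : ZMod (k + 1) → ℕ) = β) : α = β := by
  cases α
  cases β
  cases h
  rfl

theorem IsAffine.existsUnique_isRD [NeZero k] {x : Equiv.Perm ℤ} (hx : IsAffine k x) :
    (∃! α : KCode k, IsRD x α) ∧
      ∀ α : KCode k, IsRD x α → ∀ i : ℤ, (α (i : ZMod (k + 1)) : ℕ∞) = CRD x i := by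
  refine ⟨⟨⟨code k x, hx.isPeriodic.exists_code_eq_zero⟩, (hx.isRD_iff _).2 rfl,
    fun β hβ => KCode.ext ((hx.isRD_iff β).1 hβ)⟩, fun α hα i => ?_⟩
  rw [(hx.isRD_iff α).1 hα, hx.isPeriodic.coe_code_cast]

end codes

/-! ### Inversion: from right to left decompositions -/

section symmetries

variable {k : ℕ}

/-- The other kind of cyclic elements. -/
def Kind.opposite : Kind → Kind
  | .decreasing => .increasing
  | .increasing => .decreasing

theorem Kind.opposite_opposite (t : Kind) : t.opposite.opposite = t := by
  cases t <;> rfl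

theorem idxOf_reverse_lt_iff {α : Type*} [DecidableEq α] {w : List α} (hw : w.Nodup) {a b : α}
    (ha : a ∈ w) (hb : b ∈ w) : w.reverse.idxOf a < w.reverse.idxOf b ↔ w.idxOf b < w.idxOf a := by
  have key : ∀ a ∈ w, w.reverse.idxOf a + w.idxOf a + 1 = w.length := by
    intro a ha
    have h1 := List.idxOf_lt_length_of_mem ha
    have h2 : w.length - 1 - w.idxOf a < w.reverse.length := by
      rw [List.length_reverse]
      omega
    have h3 : w.reverse[w.length - 1 - w.idxOf a] = a := by
      rw [List.getElem_reverse]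
      have : w.length - 1 - (w.length - 1 - w.idxOf a) = w.idxOf a := by omega
      simp only [this]
      exact List.getElem_idxOf h1
    have h4 := (List.nodup_reverse.2 hw).idxOf_getElem _ h2
    rw [h3] at h4
    omega
  have h1 := key a ha
  have h2 := key b hb
  omega

theorem IsCyclicWord.reverse {t : Kind} {A : Finset (ZMod (k + 1))} {w : List (ZMod (k + 1))}
    (hw : IsCyclicWord t A w) : IsCyclicWord t.opposite A w.reverse := by
  obtain ⟨hnd, hA, hord⟩ := hw
  have hmem : ∀ {a}, a ∈ A → a ∈ w := fun h => by rwa [← List.mem_toFinset, hA]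
  refine ⟨List.nodup_reverse.2 hnd, by rw [List.toFinset_reverse, hA], fun j hj hj' => ?_⟩
  have := hord j hj hj'
  cases t
  · exact (idxOf_reverse_lt_iff hnd (hmem hj') (hmem hj)).2 this
  · exact (idxOf_reverse_lt_iff hnd (hmem hj) (hmem hj')).2 this

theorem IsReducedWord.reverse [NeZero k] {w : List (ZMod (k + 1))} {x : Equiv.Perm ℤ}
    (hw : IsReducedWord w x) : IsReducedWord w.reverse x⁻¹ := by
  refine ⟨by rw [wordProd_reverse, hw.1], fun v hv => ?_⟩
  have := hw.2 v.reverse (by rw [wordProd_reverse, hv, inv_inv])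
  simpa using this

theorem IsDecomposition.inv [NeZero k] {t : Kind} {x : Equiv.Perm ℤ}
    {A : List (Finset (ZMod (k + 1)))} (hA : IsDecomposition t x A) :
    IsDecomposition t.opposite x⁻¹ A.reverse := by
  obtain ⟨hS, ws, hws, hred⟩ := hA
  refine ⟨fun S h => hS S (List.mem_reverse.1 h), (ws.map List.reverse).reverse, ?_, ?_⟩
  · rw [List.forall₂_reverse_iff, List.forall₂_map_right_iff]
    exact hws.imp fun _ _ h => h.reverse
  · have := hred.reverse
    rwa [List.reverse_flatten, List.map_reverse, List.reverse_reverse,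
      ← List.reverse_reverse (List.map _ _)] at this

theorem isDecomposition_inv_iff [NeZero k] {t : Kind} {x : Equiv.Perm ℤ}
    {A : List (Finset (ZMod (k + 1)))} :
    IsDecomposition t x A ↔ IsDecomposition t.opposite x⁻¹ A.reverse := by
  refine ⟨IsDecomposition.inv, fun h => ?_⟩
  have := h.inv
  rwa [Kind.opposite_opposite, inv_inv, List.reverse_reverse] at this

theorem isMaximalLeft_iff [NeZero k] {t : Kind} {x : Equiv.Perm ℤ}
    {A : List (Finset (ZMod (k + 1)))} :
    IsMaximalLeft t x A ↔ IsMaximalRight t.opposite x⁻¹ A.reverse := by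
  refine and_congr isDecomposition_inv_iff ⟨fun h B hB => ?_, fun h B hB => ?_⟩
  · have := h B.reverse (isDecomposition_inv_iff.2 (by rwa [List.reverse_reverse]))
    rwa [List.reverse_reverse] at this
  · exact h _ hB.inv

/-! ### Reflection: from decreasing to increasing decompositions -/

/-- The involution `i ↦ -1 - i` of the residues. -/
def reflectIndex (k : ℕ) : Equiv.Perm (ZMod (k + 1)) := Equiv.subLeft (-1)

theorem reflectIndex_apply (i : ZMod (k + 1)) : reflectIndex k i = -1 - i := rfl

theorem reflectIndex_reflectIndex (i : ZMod (k + 1)) :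
    reflectIndex k (reflectIndex k i) = i := by
  rw [reflectIndex_apply, reflectIndex_apply]
  ring

/-- The conjugate of `x` by the negation of `ℤ`. -/
def reflect (x : Equiv.Perm ℤ) : Equiv.Perm ℤ := Equiv.neg ℤ * x * Equiv.neg ℤ

theorem reflect_apply (x : Equiv.Perm ℤ) (m : ℤ) : reflect x m = -x (-m) := rfl

theorem reflect_reflect (x : Equiv.Perm ℤ) : reflect (reflect x) = x := by
  ext m
  simp [reflect_apply]

theorem reflect_mul (x y : Equiv.Perm ℤ) : reflect (x * y) = reflect x * reflect y := by
  ext m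
  simp [reflect_apply]

/-- Negation sends the exchanged pair `i, i + 1` to `-1 - i, -i`; this is where the index `-1 - i`
comes from. -/
theorem reflect_simpleTransposition [NeZero k] (i : ZMod (k + 1)) :
    reflect (simpleTransposition k i) = simpleTransposition k (reflectIndex k i) := by
  ext m
  have h1 : (-(m : ZMod (k + 1)) = i) ↔ (m : ZMod (k + 1)) = -1 - i + 1 := by
    rw [neg_eq_iff_eq_neg]
    ring_nf
  have h2 : (-(m : ZMod (k + 1)) = i + 1) ↔ (m : ZMod (k + 1)) = -1 - i := by
    rw [neg_eq_iff_eq_neg]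
    ring_nf
  rw [reflect_apply, simpleTransposition_apply, simpleTransposition_apply, reflectIndex_apply]
  push_cast
  rw [if_congr h1 rfl (if_congr h2 rfl rfl)]
  split_ifs with h3 h4
  · exact absurd (h4.symm.trans h3) (ne_add_one _)
  · ring
  · ring
  · ring

theorem wordProd_map_reflectIndex [NeZero k] (w : List (ZMod (k + 1))) :
    wordProd k (w.map (reflectIndex k)) = reflect (wordProd k w) := by
  induction w with
  | nil =>
    ext m
    simp [wordProd_nil, reflect_apply]
  | cons i w ih =>
    rw [List.map_cons, wordProd_cons, wordProd_cons, reflect_mul, ih, reflect_simpleTransposition]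

theorem image_reflectIndex_image_reflectIndex (A : Finset (ZMod (k + 1))) :
    (A.image (reflectIndex k)).image (reflectIndex k) = A := by
  ext a
  simp [Finset.mem_image, reflectIndex_reflectIndex]

theorem mem_image_reflectIndex {A : Finset (ZMod (k + 1))} {a : ZMod (k + 1)} :
    a ∈ A.image (reflectIndex k) ↔ reflectIndex k a ∈ A := by
  rw [Finset.mem_image]
  constructor
  · rintro ⟨b, hb, rfl⟩
    rwa [reflectIndex_reflectIndex]
  · exact fun h => ⟨_, h, reflectIndex_reflectIndex a⟩

theorem idxOf_map_reflectIndex (w : List (ZMod (k + 1))) (a : ZMod (k + 1)) :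
    (w.map (reflectIndex k)).idxOf a = w.idxOf (reflectIndex k a) := by
  induction w with
  | nil => rfl
  | cons b w ih =>
    rw [List.map_cons, List.idxOf_cons, List.idxOf_cons, ih]
    by_cases h : reflectIndex k b = a
    · subst h
      simp [reflectIndex_reflectIndex]
    · have h' : b ≠ reflectIndex k a := fun h' => h (by rw [h', reflectIndex_reflectIndex])
      rw [beq_false_of_ne h, beq_false_of_ne h']

theorem IsCyclicWord.reflect {t : Kind} {A : Finset (ZMod (k + 1))} {w : List (ZMod (k + 1))}
    (hw : IsCyclicWord t A w) :
    IsCyclicWord t.opposite (A.image (reflectIndex k)) (w.map (reflectIndex k)) := by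
  obtain ⟨hnd, hA, hord⟩ := hw
  refine ⟨hnd.map (reflectIndex k).injective, ?_, fun j hj hj' => ?_⟩
  · ext a
    rw [mem_image_reflectIndex, ← hA, List.mem_toFinset, List.mem_toFinset, List.mem_map]
    constructor
    · rintro ⟨b, hb, rfl⟩
      rwa [reflectIndex_reflectIndex]
    · exact fun h => ⟨_, h, reflectIndex_reflectIndex a⟩
  · rw [mem_image_reflectIndex] at hj hj'
    have h1 : reflectIndex k (j - 1) - 1 = reflectIndex k j := by
      rw [reflectIndex_apply, reflectIndex_apply]
      ring
    have := hord _ hj' (by rwa [h1])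
    rw [h1] at this
    rw [idxOf_map_reflectIndex, idxOf_map_reflectIndex]
    cases t <;> exact this

theorem IsReducedWord.reflect [NeZero k] {w : List (ZMod (k + 1))} {x : Equiv.Perm ℤ}
    (hw : IsReducedWord w x) : IsReducedWord (w.map (reflectIndex k)) (reflect x) := by
  refine ⟨by rw [wordProd_map_reflectIndex, hw.1], fun v hv => ?_⟩
  have := hw.2 (v.map (reflectIndex k)) (by
    rw [wordProd_map_reflectIndex, hv, reflect_reflect])
  simpa using this

theorem IsDecomposition.reflect [NeZero k] {t : Kind} {x : Equiv.Perm ℤ}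
    {A : List (Finset (ZMod (k + 1)))} (hA : IsDecomposition t x A) :
    IsDecomposition t.opposite (reflect x) (A.map (Finset.image (reflectIndex k))) := by
  obtain ⟨hS, ws, hws, hred⟩ := hA
  refine ⟨fun S h => ?_, ws.map (List.map (reflectIndex k)), ?_, ?_⟩
  · obtain ⟨S, hSA, rfl⟩ := List.mem_map.1 h
    refine ⟨(hS S hSA).1.image _, fun h => (hS S hSA).2 ?_⟩
    rw [← image_reflectIndex_image_reflectIndex S, h, Finset.image_univ_equiv]
  · rw [List.forall₂_map_left_iff, List.forall₂_map_right_iff]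
    exact hws.imp fun _ _ h => h.reflect
  · have := hred.reflect
    rwa [List.map_flatten, List.map_reverse] at this

theorem map_image_map_image_reflectIndex (A : List (Finset (ZMod (k + 1)))) :
    (A.map (Finset.image (reflectIndex k))).map (Finset.image (reflectIndex k)) = A := by
  rw [List.map_map]
  exact List.map_id'' image_reflectIndex_image_reflectIndex A

theorem isDecomposition_reflect_iff [NeZero k] {t : Kind} {x : Equiv.Perm ℤ}
    {A : List (Finset (ZMod (k + 1)))} :
    IsDecomposition t x A ↔
      IsDecomposition t.opposite (reflect x) (A.map (Finset.image (reflectIndex k))) := by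
  refine ⟨IsDecomposition.reflect, fun h => ?_⟩
  have := h.reflect
  rwa [Kind.opposite_opposite, reflect_reflect, map_image_map_image_reflectIndex] at this

theorem map_card_map_image_reflectIndex (A : List (Finset (ZMod (k + 1)))) :
    (A.map (Finset.image (reflectIndex k))).map Finset.card = A.map Finset.card := by
  rw [List.map_map]
  exact List.map_congr_left fun S _ => Finset.card_image_of_injective S (reflectIndex k).injective

theorem isMaximalRight_reflect_iff [NeZero k] {t : Kind} {x : Equiv.Perm ℤ}
    {A : List (Finset (ZMod (k + 1)))} :
    IsMaximalRight t x A ↔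
      IsMaximalRight t.opposite (reflect x) (A.map (Finset.image (reflectIndex k))) := by
  refine and_congr isDecomposition_reflect_iff ⟨fun h B hB => ?_, fun h B hB => ?_⟩
  · have := h (B.map (Finset.image (reflectIndex k)))
      (isDecomposition_reflect_iff.2 (by rwa [map_image_map_image_reflectIndex]))
    rwa [map_card_map_image_reflectIndex] at this ⊢
  · have := h _ hB.reflect
    rwa [map_card_map_image_reflectIndex, map_card_map_image_reflectIndex] at this

/-- Carries the unique maximal decomposition across a symmetry. -/
theorem forall_iff_eq_iff_of_involutive {β : Type*} {P Q : β → Prop} {f : β → β}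
    (hf : Function.Involutive f) (h : ∀ b, P b ↔ Q (f b)) (a : β) :
    (∀ b, P b ↔ b = a) ↔ ∀ b, Q b ↔ b = f a := by
  constructor
  · intro ha b
    rw [← hf b, ← h, ha, hf.injective.eq_iff]
  · intro ha b
    rw [h, ha, hf.injective.eq_iff]

theorem isLI_iff_isRD_inv [NeZero k] {x : Equiv.Perm ℤ} {α : KCode k} :
    IsLI x α ↔ IsRD x⁻¹ α := by
  rw [IsLI, IsRD]
  exact List.reverse_involutive.toPerm.exists_congr fun A => and_congr (forall_iff_eq_iff_of_involutive List.reverse_involutive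
    (fun B => isMaximalLeft_iff) A) Iff.rfl

theorem isLD_iff_isRI_inv [NeZero k] {x : Equiv.Perm ℤ} {α : KCode k} :
    IsLD x α ↔ IsRI x⁻¹ α := by
  rw [IsLD, IsRI]
  exact List.reverse_involutive.toPerm.exists_congr fun A => and_congr (forall_iff_eq_iff_of_involutive List.reverse_involutive
    (fun B => isMaximalLeft_iff) A) Iff.rfl

/-- The code `i ↦ α (-1 - i)`. -/
def KCode.reflect (α : KCode k) : KCode k where
  toFun i := α (reflectIndex k i)
  exists_eq_zero := by
    obtain ⟨i, hi⟩ := α.exists_eq_zero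
    exact ⟨reflectIndex k i, by rwa [reflectIndex_reflectIndex]⟩

theorem KCode.reflect_apply (α : KCode k) (i : ZMod (k + 1)) :
    α.reflect i = α (reflectIndex k i) := rfl

theorem KCode.reflect_involutive : Function.Involutive (KCode.reflect (k := k)) := fun α =>
  KCode.ext (funext fun i => by
    rw [KCode.reflect_apply, KCode.reflect_apply, reflectIndex_reflectIndex])

/-- `-1 - (i + j) = (-1 - i) - j`, so reflection exchanges the two fillings. -/
theorem image_rowAdd (α : KCode k) (j : ℕ) :
    (rowAdd α j).image (reflectIndex k) = rowSub α.reflect j := by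
  ext a
  simp only [rowAdd, rowSub, Finset.mem_image, Finset.mem_filter, Finset.mem_univ, true_and]
  constructor
  · rintro ⟨_, ⟨i, hi, rfl⟩, rfl⟩
    refine ⟨reflectIndex k i, by rwa [KCode.reflect_apply, reflectIndex_reflectIndex], ?_⟩
    rw [reflectIndex_apply, reflectIndex_apply]
    ring
  · rintro ⟨i, hi, rfl⟩
    refine ⟨_, ⟨_, hi, rfl⟩, ?_⟩
    rw [reflectIndex_apply, reflectIndex_apply]
    ring

theorem isRI_iff_isRD_reflect [NeZero k] {x : Equiv.Perm ℤ} {α : KCode k} :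
    IsRI x α ↔ IsRD (reflect x) α.reflect := by
  have hinv : Function.Involutive (List.map (Finset.image (reflectIndex k))) :=
    map_image_map_image_reflectIndex
  rw [IsRI, IsRD]
  refine hinv.toPerm.exists_congr fun A => and_congr (forall_iff_eq_iff_of_involutive hinv
    (fun B => isMaximalRight_reflect_iff) A) (forall_congr' fun j => ?_)
  rw [Function.Involutive.coe_toPerm]
  have h0 : (∅ : Finset (ZMod (k + 1))) = Finset.image (reflectIndex k) ∅ := rfl
  rw [← image_rowAdd, h0, List.getD_map, ← h0,
    (Finset.image_injective (reflectIndex k).injective).eq_iff]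

/-! ### The inversion counts under the two symmetries -/

theorem CLI_eq_CRD_inv (x : Equiv.Perm ℤ) (i : ℤ) : CLI x i = CRD x⁻¹ i := by
  rw [CLI, CRD, ← x.injective.encard_image]
  congr 1
  ext j
  constructor
  · rintro ⟨j, ⟨h1, h2⟩, rfl⟩
    exact ⟨h2, by simpa using h1⟩
  · rintro ⟨h1, h2⟩
    exact ⟨x.symm j, ⟨h2, by simpa using h1⟩, by simp⟩

theorem CLD_eq_CRI_inv (x : Equiv.Perm ℤ) (i : ℤ) : CLD x i = CRI x⁻¹ i := by
  rw [CLD, CRI, ← x.injective.encard_image]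
  congr 1
  ext j
  constructor
  · rintro ⟨j, ⟨h1, h2⟩, rfl⟩
    exact ⟨h2, by simpa using h1⟩
  · rintro ⟨h1, h2⟩
    exact ⟨x.symm j, ⟨h2, by simpa using h1⟩, by simp⟩

/-- The shift in `CRI` is forced: `-(-1 - i) = i + 1`. -/
theorem CRI_eq_CRD_reflect (x : Equiv.Perm ℤ) (i : ℤ) : CRI x i = CRD (reflect x) (-1 - i) := by
  rw [CRI, CRD, ← neg_injective.encard_image]
  congr 1
  ext j
  simp only [Set.image_neg_eq_neg, Set.mem_neg, Set.mem_ofPred_eq, reflect_apply]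
  rw [show -(-1 - i) = i + 1 by ring]
  constructor <;> rintro ⟨h1, h2⟩ <;> exact ⟨by omega, by omega⟩

/-- Since `x` is a product of simple transpositions, the reversed word gives the inverse, and every
word product is affine. -/
theorem IsAffine.inv [NeZero k] {x : Equiv.Perm ℤ} (hx : IsAffine k x) : IsAffine k x⁻¹ := by
  obtain ⟨w, rfl⟩ := hx.exists_wordProd_eq
  rw [← wordProd_reverse]
  exact isAffine_wordProd _

theorem IsAffine.reflect [NeZero k] {x : Equiv.Perm ℤ} (hx : IsAffine k x) :
    IsAffine k (reflect x) := by
  obtain ⟨w, rfl⟩ := hx.exists_wordProd_eq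
  rw [← wordProd_map_reflectIndex]
  exact isAffine_wordProd _

theorem IsAffine.existsUnique_isRI [NeZero k] {x : Equiv.Perm ℤ} (hx : IsAffine k x) :
    (∃! α : KCode k, IsRI x α) ∧
      ∀ α : KCode k, IsRI x α → ∀ i : ℤ, (α (i : ZMod (k + 1)) : ℕ∞) = CRI x i := by
  obtain ⟨h1, h2⟩ := hx.reflect.existsUnique_isRD
  constructor
  · exact ((KCode.reflect_involutive (k := k)).toPerm.existsUnique_congr
      fun _ => isRI_iff_isRD_reflect).2 h1
  · intro α hα i
    have := h2 _ (isRI_iff_isRD_reflect.1 hα) (-1 - i)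
    rw [← CRI_eq_CRD_reflect, KCode.reflect_apply] at this
    rw [← this]
    congr 2
    rw [reflectIndex_apply]
    push_cast
    ring

end symmetries

end AffineCodes

/-- For every affine permutation, each of the four `k`-codes exists, is unique, and agrees with the
affine code of the same name. The index `i` runs over all integers, in particular over
`1, …, k + 1`. -/
theorem mainTheorem6 (k : ℕ) [NeZero k] (x : Equiv.Perm ℤ)
    (hx : AffineCodes.IsAffinePermutation k x) :
    ((∃! α : AffineCodes.KCode k, AffineCodes.IsRD x α) ∧
      ∀ α : AffineCodes.KCode k, AffineCodes.IsRD x α →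
        ∀ i : ℤ, (α (i : ZMod (k + 1)) : ℕ∞) = AffineCodes.CRD x i) ∧
    ((∃! α : AffineCodes.KCode k, AffineCodes.IsRI x α) ∧
      ∀ α : AffineCodes.KCode k, AffineCodes.IsRI x α →
        ∀ i : ℤ, (α (i : ZMod (k + 1)) : ℕ∞) = AffineCodes.CRI x i) ∧
    ((∃! α : AffineCodes.KCode k, AffineCodes.IsLD x α) ∧
      ∀ α : AffineCodes.KCode k, AffineCodes.IsLD x α →
        ∀ i : ℤ, (α (i : ZMod (k + 1)) : ℕ∞) = AffineCodes.CLD x i) ∧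
    ((∃! α : AffineCodes.KCode k, AffineCodes.IsLI x α) ∧
      ∀ α : AffineCodes.KCode k, AffineCodes.IsLI x α →
        ∀ i : ℤ, (α (i : ZMod (k + 1)) : ℕ∞) = AffineCodes.CLI x i) := by
  have h := hx.isAffine
  refine ⟨h.existsUnique_isRD, h.existsUnique_isRI, ?_, ?_⟩
  · simp only [AffineCodes.isLD_iff_isRI_inv, AffineCodes.CLD_eq_CRI_inv]
    exact h.inv.existsUnique_isRI
  · simp only [AffineCodes.isLI_iff_isRD_inv, AffineCodes.CLI_eq_CRD_inv]
    exact h.inv.existsUnique_isRD
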